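/- Let $k$ be a field, let $S=k[x_1,\dots,x_n]$ be the polynomial ring with its standard grading, and let $M$ be a nonzero finitely generated $\mathbb Z$-graded $S$-module. Let $c=\operatorname{codim}(M)$ be its codimension, i.e. the height of the annihilator of $M$. Let $F_\bullet\to M$ be a minimal graded free resolution of $M$ over $S$, with $F_i=\bigoplus_j S(-j)^{\beta_{ij}(M)}$, and let $$T_i(M)=\max\{\,j : \beta_{ij}(M)\neq 0\,\}=\max\{\,j : \operatorname{Tor}_i^S(M,k)_j\neq 0\,\}$$ be the $i$-th maximal graded shift of $M$. Then for every integer $i$ with $0\le i<c$ the maxima $T_i(M)$ and $T_{i+1}(M)$ exist (that is, $F_i\ne 0$ and $F_{i+1}\neq 0$), and $$T_i(M)<T_{i+1}(M).$$ -/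

import Mathlib

/-- The polynomial ring `k[x₁, …, xₙ]`. -/
abbrev PolyRing (k : Type*) [Field k] (n : ℕ) : Type _ := MvPolynomial (Fin n) k

/-- The standard grading of `k[x₁, …, xₙ]`, indexed by `ℤ`: every variable has degree `1`, and the
pieces of negative degree are zero. -/
abbrev stdGrading (k : Type*) [Field k] (n : ℕ) : ℤ → Submodule k (PolyRing k n) :=
  MvPolynomial.weightedHomogeneousSubmodule k (fun _ : Fin n => (1 : ℤ))

/-- The codimension of a module: the height of its annihilator. -/
noncomputable def Module.codim (R M : Type*) [CommRing R] [AddCommGroup M] [Module R M] : ℕ∞ :=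
  (Module.annihilator R M).height

/-- A minimal graded free resolution
`⋯ → F₂ → F₁ → F₀ → M → 0` of a graded module `M = ⨁ⱼ 𝓜 j` over `S = k[x₁, …, xₙ]`.
Here `Fᵢ = S ^ (rank i)` with its standard basis, whose `a`-th element is put in degree
`deg i a`, so that `Fᵢ = ⨁ₐ S(-deg i a)`. -/
structure MinimalGradedFreeResolution {k : Type*} [Field k] {n : ℕ} {M : Type*} [AddCommGroup M]
    [Module (PolyRing k n) M] (𝓜 : ℤ → AddSubgroup M) where
  /-- the rank of `Fᵢ` -/
  rank : ℕ → ℕ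
  /-- the degrees of the basis elements of `Fᵢ` -/
  deg : ∀ i, Fin (rank i) → ℤ
  /-- the augmentation `F₀ → M` -/
  aug : (Fin (rank 0) → PolyRing k n) →ₗ[PolyRing k n] M
  /-- the differentials `Fᵢ₊₁ → Fᵢ` -/
  d : ∀ i, (Fin (rank (i + 1)) → PolyRing k n) →ₗ[PolyRing k n] (Fin (rank i) → PolyRing k n)
  /-- the augmentation preserves degrees -/
  aug_mem : ∀ a, aug (Pi.single a 1) ∈ 𝓜 (deg 0 a)
  /-- the differentials preserve degrees -/
  d_mem : ∀ i b a, d i (Pi.single b 1) a ∈ stdGrading k n (deg (i + 1) b - deg i a)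
  aug_surjective : Function.Surjective aug
  exact_zero : Function.Exact (d 0) aug
  exact_succ : ∀ i, Function.Exact (d (i + 1)) (d i)
  /-- the image of each differential lies in `(x₁, …, xₙ) Fᵢ` -/
  minimal : ∀ i x a, d i x a ∈ MvPolynomial.idealOfVars (Fin n) k

namespace MinimalGradedFreeResolution

variable {k : Type*} [Field k] {n : ℕ} {M : Type*} [AddCommGroup M] [Module (PolyRing k n) M]
  {𝓜 : ℤ → AddSubgroup M}

/-- The graded Betti number `βᵢⱼ`: the number of summands `S(-j)` of `Fᵢ`. -/
def betti (F : MinimalGradedFreeResolution (k := k) (n := n) 𝓜) (i : ℕ) (j : ℤ) : ℕ :=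
  (Finset.univ.filter fun a => F.deg i a = j).card

/-- The `i`-th maximal graded shift `Tᵢ = max {j | βᵢⱼ ≠ 0}`
(meaningful when this set is non-empty; it is always finite). -/
noncomputable def maxShift (F : MinimalGradedFreeResolution (k := k) (n := n) 𝓜) (i : ℕ) : ℤ :=
  sSup {j | F.betti i j ≠ 0}

end MinimalGradedFreeResolution

/-! Existence of minimal graded free resolutions. -/

section Existence

variable {k : Type*} [Field k] {n : ℕ}

/-- The component of degree `e` of a polynomial. -/
noncomputable abbrev polyComp (k : Type*) [Field k] (n : ℕ) (e : ℤ) :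
    PolyRing k n →ₗ[k] PolyRing k n :=
  MvPolynomial.weightedHomogeneousComponent (fun _ : Fin n => (1 : ℤ)) e

theorem polyComp_zero (s : PolyRing k n) :
    polyComp k n 0 s = MvPolynomial.C (MvPolynomial.constantCoeff s) := by
  classical
  ext m
  rw [MvPolynomial.coeff_weightedHomogeneousComponent, MvPolynomial.coeff_C]
  have h : Finsupp.weight (fun _ : Fin n => (1 : ℤ)) m = 0 ↔ 0 = m := by
    rw [Finsupp.weight_apply, Finsupp.sum_fintype _ _ (by simp)]
    simp only [nsmul_eq_mul, mul_one]
    rw [Finset.sum_eq_zero_iff_of_nonneg (by simp)]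
    constructor
    · intro h; ext i; exact_mod_cast (h i (Finset.mem_univ i)).symm
    · rintro rfl; simp
  by_cases hm : 0 = m
  · rw [if_pos (h.2 hm), if_pos hm, ← hm, MvPolynomial.constantCoeff_eq]
  · rw [if_neg (mt h.1 hm), if_neg hm]

/-- Homogeneous components with respect to a family of subgroups of a module. -/
structure GradedComps {P : Type*} [AddCommGroup P] [Module (PolyRing k n) P]
    (G : ℤ → AddSubgroup P) where
  comp : ℤ → P →+ P
  mem : ∀ e x, comp e x ∈ G e
  sum : ∀ x, ∃ s : Finset ℤ, ∑ e ∈ s, comp e x = x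
  smul : ∀ (s : PolyRing k n) (d : ℤ) (g : P), g ∈ G d → ∀ e,
    comp e (s • g) = polyComp k n (e - d) s • g

theorem polyComp_sum (s : PolyRing k n) : ∃ t : Finset ℤ, ∑ e ∈ t, polyComp k n e s = s :=
  ⟨_, by
    rw [← finsum_eq_sum _ (MvPolynomial.weightedHomogeneousComponent_finsupp s)]
    exact MvPolynomial.sum_weightedHomogeneousComponent _ s⟩

theorem polyComp_of_mem {s : PolyRing k n} {d : ℤ} (h : s ∈ stdGrading k n d) (e : ℤ) :
    polyComp k n e s = if e = d then s else 0 :=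
  MvPolynomial.weightedHomogeneousComponent_of_mem h

/-- The components of a graded module. -/
noncomputable def GradedComps.ofDecomposition {M : Type*} [AddCommGroup M]
    [Module (PolyRing k n) M] (𝓜 : ℤ → AddSubgroup M) [DirectSum.Decomposition 𝓜]
    [SetLike.GradedSMul (stdGrading k n) 𝓜] : GradedComps (k := k) (n := n) 𝓜 where
  comp e :=
    { toFun x := DirectSum.decompose 𝓜 x e
      map_zero' := by simp
      map_add' x y := by simp }
  mem e x := (DirectSum.decompose 𝓜 x e).2
  sum x := by
    classical
    exact ⟨_, DirectSum.sum_support_decompose 𝓜 x⟩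
  smul s d g hg e := by
    classical
    change ((DirectSum.decompose 𝓜 (s • g) e : 𝓜 e) : M) = _
    have key : ∀ (f : ℤ) (s : PolyRing k n), s ∈ stdGrading k n f →
        ((DirectSum.decompose 𝓜 (s • g) e : 𝓜 e) : M) = polyComp k n (e - d) s • g := by
      intro f s hs
      have hsg : s • g ∈ 𝓜 (f + d) := SetLike.GradedSMul.smul_mem hs hg
      rw [polyComp_of_mem hs]
      by_cases h : e - d = f
      · obtain rfl : e = f + d := by omega
        rw [if_pos h, DirectSum.decompose_of_mem_same 𝓜 hsg]
      · rw [if_neg h, DirectSum.decompose_of_mem_ne 𝓜 hsg (by omega), zero_smul]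
    obtain ⟨t, ht⟩ := polyComp_sum s
    conv_lhs => rw [← ht]
    conv_rhs => rw [← ht]
    simp only [Finset.sum_smul, DirectSum.decompose_sum, DirectSum.sum_apply,
      AddSubmonoidClass.coe_finsetSum, map_sum]
    exact Finset.sum_congr rfl fun f _ =>
      key f _ (MvPolynomial.weightedHomogeneousComponent_mem _ s f)

/-- The grading of `⨁ₐ S(-d a)`. -/
def shiftedGrading (k : Type*) [Field k] (n : ℕ) {r : ℕ} (d : Fin r → ℤ) (e : ℤ) :
    AddSubgroup (Fin r → PolyRing k n) where
  carrier := {x | ∀ a, x a ∈ stdGrading k n (e - d a)}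
  add_mem' hx hy a := add_mem (hx a) (hy a)
  zero_mem' _ := zero_mem _
  neg_mem' hx a := neg_mem (hx a)

theorem polyComp_mul {s g : PolyRing k n} {d : ℤ} (hg : g ∈ stdGrading k n d) (e : ℤ) :
    polyComp k n e (s * g) = polyComp k n (e - d) s * g := by
  obtain ⟨t, ht⟩ := polyComp_sum s
  conv_lhs => rw [← ht]
  conv_rhs => rw [← ht]
  simp only [Finset.sum_mul, map_sum]
  refine Finset.sum_congr rfl fun f _ => ?_
  have hs : polyComp k n f s ∈ stdGrading k n f :=
    MvPolynomial.weightedHomogeneousComponent_mem _ s f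
  have hsg : polyComp k n f s * g ∈ stdGrading k n (f + d) := hs.mul hg
  rw [polyComp_of_mem hsg, polyComp_of_mem hs]
  by_cases h : e = f + d
  · rw [if_pos h, if_pos (by omega)]
  · rw [if_neg h, if_neg (by omega), zero_mul]

/-- The components of `⨁ₐ S(-d a)`. -/
noncomputable def GradedComps.shifted {r : ℕ} (d : Fin r → ℤ) :
    GradedComps (k := k) (n := n) (shiftedGrading k n d) where
  comp e :=
    { toFun x a := polyComp k n (e - d a) (x a)
      map_zero' := by ext1 a; simp
      map_add' x y := by ext1 a; simp }
  mem e x a := MvPolynomial.weightedHomogeneousComponent_mem _ _ _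
  sum x := by
    classical
    have h : ∀ a, (Function.support fun e => polyComp k n e (x a)).Finite := fun a =>
      MvPolynomial.weightedHomogeneousComponent_finsupp (x a)
    refine ⟨Finset.univ.biUnion fun a => (h a).toFinset.image fun e => e + d a, ?_⟩
    ext1 a
    rw [Finset.sum_apply]
    change ∑ e ∈ _, polyComp k n (e - d a) (x a) = x a
    conv_rhs => rw [← MvPolynomial.sum_weightedHomogeneousComponent
      (fun _ : Fin n => (1 : ℤ)) (x a)]
    rw [finsum_eq_sum _ (MvPolynomial.weightedHomogeneousComponent_finsupp (x a))]
    rw [← Finset.sum_image (s := (h a).toFinset) (g := fun e => e + d a)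
      (f := fun e => polyComp k n (e - d a) (x a)) (by intro u _ v _; simp) |>.trans
        (Finset.sum_congr rfl fun e _ => by rw [add_sub_cancel_right])]
    symm
    refine Finset.sum_subset (fun e he => Finset.mem_biUnion.2 ⟨a, Finset.mem_univ _, he⟩) ?_
    intro e _ he
    by_contra hne
    exact he (Finset.mem_image.2 ⟨e - d a, (h a).mem_toFinset.2 hne, by omega⟩)
  smul s c g hg e := by
    ext1 a
    change polyComp k n (e - d a) (s * g a) = polyComp k n (e - c) s * g a
    rw [polyComp_mul (hg a)]
    rw [show e - d a - (c - d a) = e - c by omega]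

/-- A homogeneous finitely generated submodule has homogeneous generators all of whose
relations have coefficients in `(x₁, …, xₙ)`. -/
theorem exists_minimal_generators {P : Type*} [AddCommGroup P] [Module (PolyRing k n) P]
    {G : ℤ → AddSubgroup P} (π : GradedComps (k := k) (n := n) G)
    (N : Submodule (PolyRing k n) P) (hN : N.FG) (hhom : ∀ x ∈ N, ∀ e, π.comp e x ∈ N) :
    ∃ (r : ℕ) (deg : Fin r → ℤ) (g : Fin r → P), (∀ a, g a ∈ G (deg a)) ∧
      Submodule.span (PolyRing k n) (Set.range g) = N ∧
      ∀ s : Fin r → PolyRing k n, ∑ a, s a • g a = 0 →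
        ∀ a, s a ∈ MvPolynomial.idealOfVars (Fin n) k := by
  classical
  have hex : ∃ r : ℕ, ∃ (deg : Fin r → ℤ) (g : Fin r → P), (∀ a, g a ∈ G (deg a)) ∧
      Submodule.span (PolyRing k n) (Set.range g) = N := by
    obtain ⟨T, hT⟩ := hN
    choose t ht using π.sum
    let U : Finset (Σ _ : P, ℤ) := T.sigma t
    refine ⟨U.card, fun a => (U.equivFin.symm a).1.2,
      fun a => π.comp (U.equivFin.symm a).1.2 (U.equivFin.symm a).1.1, fun a => π.mem _ _,
      le_antisymm ?_ ?_⟩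
    · rw [Submodule.span_le]
      rintro _ ⟨a, rfl⟩
      refine hhom _ ?_ _
      rw [← hT]
      exact Submodule.subset_span (Finset.mem_sigma.1 (U.equivFin.symm a).2).1
    · rw [← hT, Submodule.span_le]
      intro x hx
      rw [← ht x]
      refine Submodule.sum_mem _ fun e he => Submodule.subset_span ?_
      exact ⟨U.equivFin ⟨⟨x, e⟩, Finset.mem_sigma.2 ⟨hx, he⟩⟩, by simp⟩
  obtain ⟨deg, g, hg, hspan⟩ := Nat.find_spec hex
  have hmin := fun m => Nat.find_min (H := hex) (m := m)
  refine ⟨Nat.find hex, deg, g, hg, hspan, ?_⟩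
  generalize Nat.find hex = r at deg g hmin
  intro s hs a
  by_contra hsa
  have hc : MvPolynomial.constantCoeff (s a) ≠ 0 := by
    intro h
    apply hsa
    have := (MvPolynomial.mem_pow_idealOfVars_iff' (R := k) 1 (s a)).2
    rw [pow_one] at this
    apply this
    intro m hm
    obtain rfl : m = 0 := by
      have : m.degree = 0 := by omega
      exact (Finsupp.degree_eq_zero_iff m).1 this
    exact h
  have hrel : ∑ b, polyComp k n (deg a - deg b) (s b) • g b = 0 := by
    have := congrArg (π.comp (deg a)) hs
    rw [map_sum, map_zero] at this
    rw [← this]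
    exact Finset.sum_congr rfl fun b _ => (π.smul _ _ _ (hg b) _).symm
  cases r with
  | zero => exact a.elim0
  | succ r =>
    refine hmin r (Nat.lt_succ_self r) ⟨deg ∘ a.succAbove, g ∘ a.succAbove, fun b => hg _, ?_⟩
    refine le_antisymm ?_ ?_
    · rw [← hspan]
      exact Submodule.span_mono (Set.range_comp_subset_range _ _)
    · rw [← hspan, Submodule.span_le]
      have hothers : ∀ b, g (a.succAbove b) ∈
          Submodule.span (PolyRing k n) (Set.range (g ∘ a.succAbove)) := fun b =>
        Submodule.subset_span ⟨b, rfl⟩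
      rintro _ ⟨b, rfl⟩
      induction b using Fin.succAboveCases a with
      | p b => exact hothers b
      | x =>
        rw [Fin.sum_univ_succAbove _ a, sub_self, polyComp_zero] at hrel
        have h1 : (MvPolynomial.C (MvPolynomial.constantCoeff (s a)) : PolyRing k n) • g a ∈
            Submodule.span (PolyRing k n) (Set.range (g ∘ a.succAbove)) := by
          rw [eq_neg_of_add_eq_zero_left hrel]
          exact neg_mem (Submodule.sum_mem _ fun b _ => Submodule.smul_mem _ _ (hothers b))
        have h2 := Submodule.smul_mem _
          (MvPolynomial.C (MvPolynomial.constantCoeff (s a))⁻¹ : PolyRing k n) h1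
        rwa [smul_smul, ← MvPolynomial.C_mul, inv_mul_cancel₀ hc, MvPolynomial.C_1, one_smul]
          at h2

theorem ker_homogeneous {P : Type*} [AddCommGroup P] [Module (PolyRing k n) P]
    {G : ℤ → AddSubgroup P} (π : GradedComps (k := k) (n := n) G) {r : ℕ} (deg : Fin r → ℤ)
    (g : Fin r → P) (hg : ∀ a, g a ∈ G (deg a)) (x : Fin r → PolyRing k n)
    (hx : x ∈ LinearMap.ker (Fintype.linearCombination (PolyRing k n) g)) (e : ℤ) :
    (GradedComps.shifted (k := k) (n := n) deg).comp e x ∈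
      LinearMap.ker (Fintype.linearCombination (PolyRing k n) g) := by
  rw [LinearMap.mem_ker, Fintype.linearCombination_apply] at hx ⊢
  have := congrArg (π.comp e) hx
  rw [map_sum, map_zero] at this
  rw [← this]
  exact Finset.sum_congr rfl fun b _ => (π.smul _ _ _ (hg b) _).symm

/-- A homogeneous submodule of a graded free module `⨁ₐ S(-deg a)`. -/
structure HomogeneousSub (k : Type*) [Field k] (n : ℕ) where
  r : ℕ
  deg : Fin r → ℤ
  N : Submodule (PolyRing k n) (Fin r → PolyRing k n)
  hom : ∀ x ∈ N, ∀ e, (GradedComps.shifted (k := k) (n := n) deg).comp e x ∈ N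

theorem HomogeneousSub.exists_next (A : HomogeneousSub k n) :
    ∃ (B : HomogeneousSub k n)
      (f : (Fin B.r → PolyRing k n) →ₗ[PolyRing k n] (Fin A.r → PolyRing k n)),
      (∀ b a, f (Pi.single b 1) a ∈ stdGrading k n (B.deg b - A.deg a)) ∧
      LinearMap.range f = A.N ∧ LinearMap.ker f = B.N ∧
      ∀ x ∈ B.N, ∀ a, x a ∈ MvPolynomial.idealOfVars (Fin n) k := by
  obtain ⟨r, deg, g, hg, hspan, hmin⟩ := exists_minimal_generators
    (GradedComps.shifted (k := k) (n := n) A.deg) A.N (IsNoetherian.noetherian _) A.hom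
  refine ⟨⟨r, deg, LinearMap.ker (Fintype.linearCombination (PolyRing k n) g),
    ker_homogeneous (GradedComps.shifted A.deg) deg g hg⟩,
    Fintype.linearCombination (PolyRing k n) g, fun b a => ?_, ?_, rfl, fun x hx => ?_⟩
  · rw [Fintype.linearCombination_apply_single, one_smul]
    exact hg b a
  · rw [Fintype.range_linearCombination, hspan]
  · exact hmin x (by simpa [Fintype.linearCombination_apply] using hx)

/-- Every finitely generated graded module has a minimal graded free resolution. -/
theorem MinimalGradedFreeResolution.nonempty {M : Type*} [AddCommGroup M]
    [Module (PolyRing k n) M] [Module.Finite (PolyRing k n) M] (𝓜 : ℤ → AddSubgroup M)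
    [DirectSum.Decomposition 𝓜] [SetLike.GradedSMul (stdGrading k n) 𝓜] :
    Nonempty (MinimalGradedFreeResolution (k := k) (n := n) 𝓜) := by
  let π : GradedComps (k := k) (n := n) 𝓜 := GradedComps.ofDecomposition 𝓜
  obtain ⟨r, deg, g, hg, hspan, hmin⟩ := exists_minimal_generators π ⊤ Module.Finite.fg_top
    (fun _ _ _ => Submodule.mem_top)
  choose next f hf hrange hker hm using HomogeneousSub.exists_next (k := k) (n := n)
  let A₀ : HomogeneousSub k n := ⟨r, deg, LinearMap.ker (Fintype.linearCombination _ g),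
    ker_homogeneous π deg g hg⟩
  let A : ℕ → HomogeneousSub k n := fun i => Nat.rec A₀ (fun _ B => next B) i
  have hA : ∀ i x, x ∈ (A i).N → ∀ a, x a ∈ MvPolynomial.idealOfVars (Fin n) k := by
    intro i x hx
    cases i with
    | zero => exact hmin x (by simpa [Fintype.linearCombination_apply] using LinearMap.mem_ker.1 hx)
    | succ i => exact hm (A i) x hx
  refine ⟨{ rank := fun i => (A i).r
            deg := fun i => (A i).deg
            aug := Fintype.linearCombination _ g
            d := fun i => f (A i)
            aug_mem := fun a => ?_
            d_mem := fun i => hf (A i)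
            aug_surjective := ?_
            exact_zero := ?_
            exact_succ := fun i => ?_
            minimal := fun i x => hA i _ ?_ }⟩
  · have := hg a
    rw [← one_smul (PolyRing k n) (g a), ← Fintype.linearCombination_apply_single] at this
    exact this
  · rw [← LinearMap.range_eq_top]
    exact (Fintype.range_linearCombination _ g).trans hspan
  · rw [LinearMap.exact_iff]
    exact (hrange A₀).symm
  · rw [LinearMap.exact_iff]
    exact (hker (A i)).trans (hrange (A (i + 1))).symm
  · rw [← hrange]
    exact ⟨x, rfl⟩

end Existence

/-!
The idea is to dualize the resolution. Let `c` be the height of the annihilator of `M`. The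
polynomial ring `S` is Cohen–Macaulay, so the annihilator contains an `S`-regular sequence of length
`c`, and therefore `Extⁱ(M, S) = 0` for `i < c`: a linear form on `Fᵢ` that vanishes on the image of
`Fᵢ₊₁` factors through `Fᵢ → Fᵢ₋₁` (and is zero if `i = 0`). Let `a` be a basis element of `Fᵢ`, and
suppose that no basis element of `Fᵢ₊₁` has larger degree. The coordinates at `a` of the images of
the basis of `Fᵢ₊₁` are then forms of degree at most `0` lying in `(x₁, …, xₙ)`, so they are zero,
and the coordinate function of `a` is a cocycle. As a coboundary it takes values in `(x₁, …, xₙ)`,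
because the resolution is minimal; but its value at `a` is `1`. Hence every degree in `Fᵢ` is
exceeded by one in `Fᵢ₊₁` (`MinimalGradedFreeResolution.exists_deg_lt`).

The regular sequence comes from `MvPolynomial.exists_isWeaklyRegular_of_le_height`, by induction on
the number of variables. After a change of variables (Nagata) a nonzero ideal `I` of `A[X]`, with `A`
a polynomial ring in one variable less, contains a monic `f`. As `A[X] ⧸ (f)` is finite and free over
`A`, the height of `I ∩ A` is at least that of `I` minus one, and a regular sequence in `I ∩ A`
extends `f` to a regular sequence in `I`.

The vanishing of `Ext` is `exists_eq_comp_of_comp_eq_zero`, stated for cocycles on a projective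
resolution and proved by induction on the length of the regular sequence.
-/

/-! ### Heights of ideals in `R[X]` -/

section Height

open Polynomial Ideal

attribute [local instance] Polynomial.algebra Polynomial.isLocalization in
/-- Localizing `R` at the contraction `p` of `P` makes `p` maximal. A maximal ideal of `Rₚ[X]`
containing the extension of `P` then lies over `pRₚ`, so that its height is known. -/
theorem Polynomial.height_le_height_comap_C_add_one {R : Type*} [CommRing R] [IsNoetherianRing R]
    (P : Ideal R[X]) [P.IsPrime] : P.height ≤ (P.comap C).height + 1 := by
  set p : Ideal R := P.comap C with hp
  have : P.LiesOver p := ⟨rfl⟩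
  have : p.IsPrime := by rw [hp]; infer_instance
  let Rₚ := Localization.AtPrime p
  set p' : Ideal Rₚ := p.map (algebraMap R Rₚ) with p'_def
  have : p'.IsMaximal := by
    rw [p'_def, Localization.AtPrime.map_eq_maximalIdeal]
    exact IsLocalRing.maximalIdeal.isMaximal Rₚ
  let P' : Ideal Rₚ[X] := P.map (algebraMap R[X] Rₚ[X])
  have disj : Disjoint (p.primeCompl.map C : Set R[X]) P := by
    refine Set.disjoint_left.mpr fun a ⟨b, hb⟩ ha ↦ hb.1 ?_
    rwa [← hb.2] at ha
  have hP' : P'.IsPrime :=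
    IsLocalization.isPrime_of_isPrime_disjoint (p.primeCompl.map C) _ _ ‹_› disj
  have : P'.LiesOver p' := IsLocalization.liesOver_of_isPrime_of_disjoint p.primeCompl _ _ disj
  have eq1 : p.height = p'.height := by
    rw [IsLocalization.height_map_of_disjoint p.primeCompl]
    exact Disjoint.symm <| Set.disjoint_left.mpr fun _ a b ↦ b a
  have eq2 : P.height = P'.height := by
    rw [IsLocalization.height_map_of_disjoint (Submonoid.map C <| p.primeCompl) _ disj]
  obtain ⟨Q, hQ, hPQ⟩ := P'.exists_le_maximal hP'.ne_top
  have : Q.LiesOver p' := ⟨by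
    refine IsMaximal.eq_of_le inferInstance IsPrime.ne_top' ?_
    rw [P'.over_def p']
    exact Ideal.comap_mono hPQ⟩
  rw [eq1, eq2, ← Polynomial.height_eq_height_add_one p' Q]
  exact Ideal.height_mono hPQ

/-- Since `f` is monic, `R[X] ⧸ (f)` is integral over `R`, so every minimal prime of `I ∩ R` is the
contraction of a prime of `R[X]` containing `I`. -/
theorem Polynomial.height_le_height_comap_C_add_one_of_monic {R : Type*} [CommRing R]
    [IsNoetherianRing R] (I : Ideal R[X]) {f : R[X]} (hf : f.Monic) (hfI : f ∈ I) :
    I.height ≤ (I.comap C).height + 1 := by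
  rw [(I.comap C).height_eq_inf_minimalPrimes]
  rw [iInf_subtype', ENat.iInf_add]
  refine le_iInf fun ⟨q, hq⟩ => ?_
  have : q.IsPrime := hq.1.1
  have : Module.Finite R (AdjoinRoot f) := hf.finite_adjoinRoot
  have hmk : (I.map (AdjoinRoot.mk f)).comap (AdjoinRoot.mk f) = I := by
    rw [Ideal.comap_map_of_surjective _ AdjoinRoot.mk_surjective, ← RingHom.ker_eq_comap_bot,
      sup_eq_left]
    intro x hx
    rw [RingHom.mem_ker, AdjoinRoot.mk_eq_zero] at hx
    exact Ideal.mem_of_dvd _ hx hfI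
  obtain ⟨Q, hIQ, hQ, hQq⟩ := Ideal.exists_ideal_over_prime_of_isIntegral q
    (I.map (AdjoinRoot.mk f)) (by
      rw [AdjoinRoot.algebraMap_eq, AdjoinRoot.of, ← Ideal.comap_comap, hmk]
      exact hq.1.2)
  have h1 : I ≤ Q.comap (AdjoinRoot.mk f) := hmk ▸ Ideal.comap_mono hIQ
  have h2 : (Q.comap (AdjoinRoot.mk f)).comap C = q := by
    rw [← hQq, AdjoinRoot.algebraMap_eq, AdjoinRoot.of, ← Ideal.comap_comap]
  calc I.height ≤ (Q.comap (AdjoinRoot.mk f)).height := Ideal.height_mono h1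
    _ ≤ _ := h2 ▸ Polynomial.height_le_height_comap_C_add_one _

end Height

/-! ### Weakly regular sequences in polynomial rings -/

section Regular

open Polynomial RingTheory.Sequence Pointwise

/-- The quotient `R[X] ⧸ (f)` is free over `R`, hence flat, so an `R`-regular sequence stays regular
on it. -/
theorem Polynomial.isWeaklyRegular_cons_map_C {R : Type*} [CommRing R] {f : R[X]} (hf : f.Monic)
    {rs : List R} (hrs : IsWeaklyRegular R rs) : IsWeaklyRegular R[X] (f :: rs.map C) := by
  have : Module.Free R (AdjoinRoot f) := hf.free_adjoinRoot
  have h1 : IsWeaklyRegular (R[X] ⧸ Ideal.span {f})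
      ((rs.map C).map (algebraMap R[X] (R[X] ⧸ Ideal.span {f}))) := by
    rw [List.map_map]
    exact hrs.of_flat (S := AdjoinRoot f)
  rw [isWeaklyRegular_map_algebraMap_iff] at h1
  refine .cons (fun x y h => hf.isRegular.left h) ?_
  have e : (R[X] ⧸ Ideal.span {f}) ≃ₗ[R[X]] QuotSMulTop f R[X] :=
    Submodule.quotEquivOfEq _ _ (by
      rw [← Submodule.ideal_span_singleton_smul, smul_eq_mul, Ideal.mul_top])
  exact (e.isWeaklyRegular_congr _).1 h1

theorem RingEquiv.isWeaklyRegular_map {R S : Type*} [CommRing R] [CommRing S] (e : R ≃+* S)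
    {rs : List R} (hrs : IsWeaklyRegular R rs) : IsWeaklyRegular S (rs.map e) :=
  (e.toAddEquiv.isWeaklyRegular_congr <| List.forall₂_map_right_iff.mpr <|
    List.forall₂_same.mpr fun r _ x => map_mul e r x).1 hrs

end Regular

namespace MvPolynomial

/-- The substitution `xᵢ₊₁ ↦ xᵢ₊₁ + x₀ ^ r i`, followed by the identification of
`k[x₀, …, xₙ]` with `k[x₁, …, xₙ][x₀]`. -/
theorem exists_algEquiv_X_eq_X_pow_add_C (k : Type*) [Field k] {n : ℕ} (r : Fin n → ℕ) :
    ∃ Φ : MvPolynomial (Fin (n + 1)) k ≃ₐ[k] Polynomial (MvPolynomial (Fin n) k),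
      Φ (X 0) = Polynomial.X ∧
      ∀ i : Fin n, Φ (X i.succ) = Polynomial.X ^ r i + Polynomial.C (X i) := by
  let T : k → MvPolynomial (Fin (n + 1)) k →ₐ[k] MvPolynomial (Fin (n + 1)) k := fun c =>
    aeval (Fin.cons (X 0) fun i => X i.succ + c • X 0 ^ r i)
  have hT : ∀ c, (T c).comp (T (-c)) = AlgHom.id _ _ := by
    intro c
    rw [comp_aeval, ← MvPolynomial.aeval_X_left]
    ext i v
    cases i using Fin.cases <;> simp [T]
  refine ⟨(AlgEquiv.ofAlgHom (T 1) (T (-1)) (hT 1) (by simpa using hT (-1))).trans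
    (finSuccEquiv k n), ?_, fun i => ?_⟩
  · simp [T, finSuccEquiv_X_zero]
  · simp [T, finSuccEquiv_X_zero, finSuccEquiv_X_succ, add_comm]

/-- Nagata's change of variables. The exponents `r i` are distinct powers of a number larger than
every exponent in `f`, so that distinct monomials of `f` are sent to polynomials of distinct degrees
and the one of largest degree provides the leading coefficient. -/
theorem exists_algEquiv_isUnit_leadingCoeff {k : Type*} [Field k] {n : ℕ}
    {f : MvPolynomial (Fin (n + 1)) k} (hf : f ≠ 0) :
    ∃ Φ : MvPolynomial (Fin (n + 1)) k ≃ₐ[k] Polynomial (MvPolynomial (Fin n) k),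
      IsUnit (Φ f).leadingCoeff := by
  classical
  set N := 2 + f.totalDegree
  let r : Fin (n + 1) → ℕ := fun i => N ^ i.1
  obtain ⟨Φ, hX0, hXs⟩ := exists_algEquiv_X_eq_X_pow_add_C k fun i : Fin n => r i.succ
  have hX : ∀ i, (Φ (X i)).Monic ∧ (Φ (X i)).natDegree = r i := by
    intro i
    cases i using Fin.cases with
    | zero => rw [hX0]; exact ⟨Polynomial.monic_X, by simp [r]⟩
    | succ i =>
      rw [hXs]
      have : r i.succ ≠ 0 := by positivity
      exact ⟨Polynomial.monic_X_pow_add_C _ this, Polynomial.natDegree_X_pow_add_C⟩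
  have hmon : ∀ v : Fin (n + 1) →₀ ℕ, (Φ (monomial v 1)).Monic ∧
      (Φ (monomial v 1)).natDegree = ∑ i, r i * v i := by
    intro v
    rw [monomial_eq, C_1, one_mul, Finsupp.prod_fintype _ _ (by simp), map_prod]
    have h : ∀ i ∈ Finset.univ, (Φ (X i ^ v i)).Monic := fun i _ => by
      rw [map_pow]; exact (hX i).1.pow _
    refine ⟨Polynomial.monic_prod_of_monic _ _ h, ?_⟩
    rw [Polynomial.natDegree_prod_of_monic _ _ h]
    refine Finset.sum_congr rfl fun i _ => ?_
    rw [map_pow, (hX i).1.natDegree_pow, (hX i).2, mul_comm]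
  have hterm : ∀ v, Φ (monomial v (coeff v f)) =
      Polynomial.C (C (coeff v f)) * Φ (monomial v 1) := by
    intro v
    rw [← mul_one (coeff v f), ← C_mul_monomial, map_mul, mul_one]
    congr 1
    exact Φ.commutes _
  have hlt : ∀ v ∈ f.support, ∀ i, v i < N := fun v hv i =>
    ((monomial_le_degreeOf i hv).trans (degreeOf_le_totalDegree f i)).trans_lt (by omega)
  have hinj : ∀ v ∈ f.support, ∀ w ∈ f.support,
      ∑ i, r i * v i = ∑ i, r i * w i → v = w := by
    intro v hv w hw h
    refine Finsupp.ext <| congrFun <| List.ofFn_inj.mp ?_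
    apply Nat.ofDigits_inj_of_len_eq (b := N) (by omega) (by simp)
    · intro l hl
      obtain ⟨i, rfl⟩ := (List.mem_ofFn' _ _).1 hl
      exact hlt v hv i
    · intro l hl
      obtain ⟨i, rfl⟩ := (List.mem_ofFn' _ _).1 hl
      exact hlt w hw i
    -- Both sums are values of base `N` expansions whose digits are the exponents.
    simpa only [Nat.ofDigits_eq_sum_mapIdx, List.mapIdx_eq_ofFn, List.get_ofFn, List.length_ofFn,
      Fin.val_cast, mul_comm, List.sum_ofFn, r] using! h
  obtain ⟨v, hv, hmax⟩ := Finset.exists_max_image f.support (fun v => ∑ i, r i * v i)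
    (support_nonempty.mpr hf)
  have hcv : coeff v f ≠ 0 := mem_support_iff.1 hv
  have hsum : Φ f = Φ (monomial v (coeff v f)) +
      ∑ w ∈ f.support.erase v, Φ (monomial w (coeff w f)) := by
    conv_lhs => rw [← f.support_sum_monomial_coeff, map_sum]
    exact (Finset.add_sum_erase _ _ hv).symm
  have hdeg : ∀ w ∈ f.support, (Φ (monomial w (coeff w f))).degree = ↑(∑ i, r i * w i) := by
    intro w hw
    have h0 : (C (coeff w f) : MvPolynomial (Fin n) k) ≠ 0 := by
      simpa using mem_support_iff.1 hw
    rw [hterm, Polynomial.degree_C_mul_of_mul_ne_zero, Polynomial.degree_eq_natDegree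
      (hmon w).1.ne_zero, (hmon w).2]
    rwa [(hmon w).1.leadingCoeff, mul_one]
  refine ⟨Φ, ?_⟩
  rw [hsum, Polynomial.leadingCoeff_add_of_degree_lt', hterm, Polynomial.leadingCoeff_mul_monic
    (hmon v).1, Polynomial.leadingCoeff_C]
  · exact hcv.isUnit.map C
  · refine (Polynomial.degree_sum_le _ _).trans_lt ?_
    rw [Finset.sup_lt_iff (by rw [hdeg v hv]; exact WithBot.bot_lt_coe _)]
    intro w hw
    obtain ⟨hwv, hw⟩ := Finset.mem_erase.1 hw
    rw [hdeg v hv, hdeg w hw, Nat.cast_lt]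
    exact (hmax w hw).lt_of_ne fun h => hwv (hinj w hw v hv h)

open RingTheory.Sequence in
/-- The grade of a proper ideal of `k[x₁, …, xₙ]` is at least its height. -/
theorem exists_isWeaklyRegular_of_le_height {k : Type*} [Field k] {n : ℕ}
    {I : Ideal (MvPolynomial (Fin n) k)} (hI : I ≠ ⊤) {c : ℕ} (hc : c ≤ I.height) :
    ∃ rs : List (MvPolynomial (Fin n) k), rs.length = c ∧ (∀ r ∈ rs, r ∈ I) ∧
      IsWeaklyRegular (MvPolynomial (Fin n) k) rs := by
  induction n generalizing c with
  | zero =>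
    have h1 := (Ideal.height_le_ringKrullDim_of_ne_top hI)
    rw [ringKrullDim_of_isNoetherianRing, ringKrullDim_eq_zero_of_field] at h1
    have h2 : (c : WithBot ℕ∞) ≤ 0 :=
      (WithBot.coe_le_coe.2 hc).trans (by simpa using h1)
    obtain rfl : c = 0 := by exact_mod_cast nonpos_iff_eq_zero.1 (by exact_mod_cast h2)
    exact ⟨[], rfl, by simp, .nil _ _⟩
  | succ n ih =>
    cases c with
    | zero => exact ⟨[], rfl, by simp, .nil _ _⟩
    | succ c =>
      have hbot : I ≠ ⊥ := by
        rintro rfl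
        rw [Ideal.height_bot] at hc
        simp at hc
      obtain ⟨f, hfI, hf⟩ := Submodule.exists_mem_ne_zero_of_ne_bot hbot
      obtain ⟨Φ, hΦ⟩ := exists_algEquiv_isUnit_leadingCoeff hf
      let e : MvPolynomial (Fin (n + 1)) k ≃+* Polynomial (MvPolynomial (Fin n) k) := Φ.toRingEquiv
      let I' := I.comap e.symm
      obtain ⟨g, hg, hgI⟩ : ∃ g : Polynomial (MvPolynomial (Fin n) k), g.Monic ∧ g ∈ I' :=
        ⟨_, Polynomial.monic_of_isUnit_leadingCoeff_inv_smul hΦ,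
          Submodule.smul_of_tower_mem _ _ (by
            change Φ.symm (Φ f) ∈ I
            rwa [Φ.symm_apply_apply])⟩
      have hht : I'.height = I.height := e.symm.height_comap I
      have hle := Polynomial.height_le_height_comap_C_add_one_of_monic I' hg hgI
      rw [hht] at hle
      have hc' : (c : ℕ∞) ≤ (I'.comap Polynomial.C).height := by
        have := hc.trans hle
        push_cast at this
        exact (ENat.add_le_add_iff_right (by simp)).1 this
      obtain ⟨rs, hlen, hmem, hreg⟩ := ih
        (Ideal.comap_ne_top _ (Ideal.comap_ne_top _ hI)) hc'
      refine ⟨(g :: rs.map Polynomial.C).map e.symm, by simp [hlen], ?_,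
        e.symm.isWeaklyRegular_map (Polynomial.isWeaklyRegular_cons_map_C hg hreg)⟩
      intro r hr
      obtain ⟨s, hs, rfl⟩ := List.mem_map.1 hr
      rcases List.mem_cons.1 hs with rfl | hs
      · exact hgI
      · obtain ⟨t, ht, rfl⟩ := List.mem_map.1 hs
        exact hmem t ht

end MvPolynomial

/-! ### Cocycles on a projective resolution -/

section Complex

open RingTheory.Sequence Pointwise

theorem LinearMap.exists_comp_eq_of_range_le {R P A B : Type*} [CommRing R] [AddCommGroup P]
    [Module R P] [Module.Projective R P] [AddCommGroup A] [Module R A] [AddCommGroup B]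
    [Module R B] (d : A →ₗ[R] B) (g : P →ₗ[R] B) (h : ∀ x, g x ∈ LinearMap.range d) :
    ∃ l : P →ₗ[R] A, d ∘ₗ l = g := by
  obtain ⟨l, hl⟩ := Module.projective_lifting_property d.rangeRestrict (g.codRestrict _ h)
    d.surjective_rangeRestrict
  exact ⟨l, LinearMap.ext fun x => congrArg Subtype.val (LinearMap.congr_fun hl x)⟩

variable {R : Type*} [CommRing R] {P : ℕ → Type*} [∀ i, AddCommGroup (P i)] [∀ i, Module R (P i)]
  {d : ∀ i, P (i + 1) →ₗ[R] P i}

/-- The vanishing of `Ext⁰(M, N) = Hom(M, N)`, for `M` the cokernel of `d 0`, when an `N`-regular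
element annihilates `M`. -/
theorem eq_zero_of_comp_eq_zero {f : R} (hf : ∀ x : P 0, f • x ∈ LinearMap.range (d 0))
    {N : Type*} [AddCommGroup N] [Module R N] (hN : IsSMulRegular N f) {φ : P 0 →ₗ[R] N}
    (hφ : φ ∘ₗ d 0 = 0) : φ = 0 := by
  ext x
  obtain ⟨y, hy⟩ := hf x
  refine hN ?_
  change f • φ x = f • (0 : N)
  rw [← map_smul, ← hy, smul_zero]
  exact LinearMap.congr_fun hφ y

variable [∀ i, Module.Projective R (P i)]

/-- If `f` annihilates the cokernel of `d 0`, then multiplication by `f` on the complex is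
null-homotopic; `h` is the component of a homotopy in position `i`. The relation
`d i ∘ h = f - h' ∘ d (i - 1)` is recorded only on the image of `d i`, where the component `h'` in
position `i - 1` drops out. -/
theorem exists_homotopy (hd : ∀ i, Function.Exact (d (i + 1)) (d i)) {f : R}
    (hf : ∀ x : P 0, f • x ∈ LinearMap.range (d 0)) (i : ℕ) :
    ∃ h : P i →ₗ[R] P (i + 1), ∀ y, d i (h (d i y)) = f • d i y := by
  induction i with
  | zero =>
    obtain ⟨h, hh⟩ := (d 0).exists_comp_eq_of_range_le (f • LinearMap.id) (by simpa using hf)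
    exact ⟨h, fun y => by simpa using LinearMap.congr_fun hh (d 0 y)⟩
  | succ i ih =>
    obtain ⟨h, hh⟩ := ih
    obtain ⟨h', hh'⟩ := (d (i + 1)).exists_comp_eq_of_range_le
      (f • LinearMap.id - h ∘ₗ d i) (fun x => (hd i _).1 (by simp [hh]))
    refine ⟨h', fun y => ?_⟩
    simpa [(hd i).apply_apply_eq_zero] using LinearMap.congr_fun hh' (d (i + 1) y)

/-- The vanishing of `Extⁱ⁺¹(M, N)`, for `M` the cokernel of `d 0`, when `M` is annihilated by the
members of an `N`-regular sequence of length greater than `i + 1`. For the first member `f`, a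
homotopy turns the cocycle `φ` into a cochain `ψ` with `f φ = ψ ∘ d i`; modulo `f` it is a cocycle,
which by induction is a coboundary, and this allows `f` to be cancelled. -/
theorem exists_eq_comp_of_comp_eq_zero (hd : ∀ i, Function.Exact (d (i + 1)) (d i)) {rs : List R}
    (hrs : ∀ r ∈ rs, ∀ x : P 0, r • x ∈ LinearMap.range (d 0))
    {N : Type*} [AddCommGroup N] [Module R N] (hN : IsWeaklyRegular N rs) {i : ℕ}
    (hi : i + 1 < rs.length) {φ : P (i + 1) →ₗ[R] N} (hφ : φ ∘ₗ d (i + 1) = 0) :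
    ∃ ψ : P i →ₗ[R] N, φ = ψ ∘ₗ d i := by
  induction rs generalizing N i with
  | nil => simp at hi
  | cons f rs ih =>
    rw [isWeaklyRegular_cons_iff] at hN
    obtain ⟨hreg, hN⟩ := hN
    have hrs' : ∀ r ∈ rs, ∀ x : P 0, r • x ∈ LinearMap.range (d 0) :=
      fun r hr => hrs r (List.mem_cons_of_mem _ hr)
    obtain ⟨h, hh⟩ := exists_homotopy hd (hrs f List.mem_cons_self) i
    -- `φ ∘ h` is the cochain whose coboundary is `f φ`.
    have hfφ : ∀ y, φ (h (d i y)) = f • φ y := by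
      intro y
      obtain ⟨z, hz⟩ := (hd i (f • y - h (d i y))).1 (by simp [hh])
      have := LinearMap.congr_fun hφ z
      rw [LinearMap.comp_apply, hz, map_sub, map_smul, LinearMap.zero_apply, sub_eq_zero] at this
      exact this.symm
    let q : N →ₗ[R] QuotSMulTop f N := Submodule.mkQ _
    have hq : ∀ x, q (f • x) = 0 := fun x =>
      (Submodule.Quotient.mk_eq_zero _).2 (Submodule.smul_mem_pointwise_smul x f ⊤ trivial)
    have hcocycle : (q ∘ₗ φ ∘ₗ h) ∘ₗ d i = 0 := by
      ext y
      simp [hfφ, hq, -map_smul]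
    -- A cocycle `χ` with values in `N` that agrees with `φ ∘ h` modulo `f`.
    obtain ⟨χ, hχ, hχq⟩ : ∃ χ : P i →ₗ[R] N, χ ∘ₗ d i = 0 ∧ q ∘ₗ χ = q ∘ₗ φ ∘ₗ h := by
      cases i with
      | zero =>
        cases rs with
        | nil => simp at hi
        | cons g rs =>
          rw [isWeaklyRegular_cons_iff] at hN
          exact ⟨0, by simp, by
            rw [eq_zero_of_comp_eq_zero (hrs' g List.mem_cons_self) hN.1 hcocycle,
              LinearMap.comp_zero]⟩
      | succ i =>
        obtain ⟨χ', hχ'⟩ := ih hrs' hN (by simpa using hi) hcocycle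
        obtain ⟨χ, hχ⟩ := Module.projective_lifting_property q χ' (Submodule.mkQ_surjective _)
        refine ⟨χ ∘ₗ d i, ?_, ?_⟩
        · rw [LinearMap.comp_assoc, (hd i).linearMap_comp_eq_zero, LinearMap.comp_zero]
        · rw [hχ', ← hχ, LinearMap.comp_assoc]
    obtain ⟨θ, hθ⟩ := (f • (LinearMap.id : N →ₗ[R] N)).exists_comp_eq_of_range_le (φ ∘ₗ h - χ)
      (fun x => by
        have : q (φ (h x) - χ x) = 0 := by
          rw [map_sub, sub_eq_zero]
          exact (LinearMap.congr_fun hχq x).symm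
        obtain ⟨y, -, hy⟩ := (Submodule.Quotient.mk_eq_zero _).1 this
        exact ⟨y, hy⟩)
    refine ⟨θ, LinearMap.ext fun y => hreg ?_⟩
    have h1 := LinearMap.congr_fun hθ (d i y)
    have h2 : χ (d i y) = 0 := LinearMap.congr_fun hχ y
    simpa [hfφ, h2] using h1.symm

end Complex

/-! ### Maximal shifts -/

namespace MvPolynomial

theorem one_notMem_idealOfVars (σ R : Type*) [CommRing R] [Nontrivial R] :
    (1 : MvPolynomial σ R) ∉ idealOfVars σ R := by
  intro h
  rw [← pow_one (idealOfVars σ R), mem_pow_idealOfVars_iff'] at h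
  have := h 0 (by simp)
  simp at this

end MvPolynomial

theorem eq_zero_of_mem_stdGrading_of_mem_idealOfVars {k : Type*} [Field k] {n : ℕ} {e : ℤ}
    (he : e ≤ 0) {p : PolyRing k n} (hp : p ∈ stdGrading k n e)
    (hp' : p ∈ MvPolynomial.idealOfVars (Fin n) k) : p = 0 := by
  ext m
  by_contra hm
  rw [MvPolynomial.coeff_zero] at hm
  have h1 : Finsupp.weight (fun _ : Fin n => (1 : ℤ)) m = e := hp hm
  rw [Finsupp.weight_apply, Finsupp.sum_fintype _ _ (by simp)] at h1
  simp only [nsmul_eq_mul, mul_one] at h1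
  rw [← pow_one (MvPolynomial.idealOfVars (Fin n) k), MvPolynomial.mem_pow_idealOfVars_iff'] at hp'
  refine hm (hp' m ?_)
  rw [Finsupp.degree_eq_sum, Nat.lt_one_iff]
  have : 0 ≤ ∑ i, (m i : ℤ) := Finset.sum_nonneg fun _ _ => by positivity
  zify
  omega

namespace MinimalGradedFreeResolution

variable {k : Type*} [Field k] {n : ℕ} {M : Type*} [AddCommGroup M] [Module (PolyRing k n) M]
  {𝓜 : ℤ → AddSubgroup M}

/-- If no generator of `Fᵢ₊₁` had degree larger than that of the generator `a` of `Fᵢ`, the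
coordinate function of `a` would vanish on the image of `Fᵢ₊₁`, hence be a coboundary, and take its
value `1` at `a` in `(x₁, …, xₙ)`. -/
theorem exists_deg_lt (F : MinimalGradedFreeResolution (k := k) (n := n) 𝓜)
    {c : ℕ} (hc : Module.codim (PolyRing k n) M = c) {i : ℕ} (hi : i < c) (a : Fin (F.rank i)) :
    ∃ b, F.deg i a < F.deg (i + 1) b := by
  by_contra! hdeg
  obtain ⟨rs, hlen, hmem, hreg⟩ := MvPolynomial.exists_isWeaklyRegular_of_le_height
    (I := Module.annihilator (PolyRing k n) M) (c := c)
    (by rintro h; rw [Module.codim, h, Ideal.height_top] at hc; simp at hc) hc.ge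
  have hann : ∀ r ∈ rs, ∀ x, r • x ∈ LinearMap.range (F.d 0) := fun r hr x =>
    (F.exact_zero _).1 (by rw [map_smul, Module.mem_annihilator.1 (hmem r hr)])
  let φ : (Fin (F.rank i) → PolyRing k n) →ₗ[PolyRing k n] PolyRing k n := LinearMap.proj a
  have hφ : φ ∘ₗ F.d i = 0 := by
    refine LinearMap.pi_ext' fun b => LinearMap.ext_ring ?_
    exact eq_zero_of_mem_stdGrading_of_mem_idealOfVars (sub_nonpos.2 (hdeg b)) (F.d_mem i b a)
      (F.minimal i _ a)
  have hφa : φ (Pi.single a 1) = 1 := by simp [φ]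
  refine MvPolynomial.one_notMem_idealOfVars (Fin n) k ?_
  rw [← hφa]
  cases i with
  | zero =>
    cases rs with
    | nil => simp at hlen; omega
    | cons f rs =>
      rw [RingTheory.Sequence.isWeaklyRegular_cons_iff] at hreg
      rw [eq_zero_of_comp_eq_zero (P := fun i => Fin (F.rank i) → PolyRing k n)
        (hann f List.mem_cons_self) hreg.1 hφ]
      exact zero_mem _
  | succ i =>
    obtain ⟨ψ, hψ⟩ := exists_eq_comp_of_comp_eq_zero
      (P := fun i => Fin (F.rank i) → PolyRing k n) F.exact_succ hann hreg (hlen ▸ hi) hφ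
    rw [hψ, LinearMap.comp_apply, LinearMap.pi_apply_eq_sum_univ ψ]
    exact Ideal.sum_mem _ fun b _ => Ideal.mul_mem_right _ _ (F.minimal i _ b)

theorem rank_zero_pos [Nontrivial M] (F : MinimalGradedFreeResolution (k := k) (n := n) 𝓜) :
    0 < F.rank 0 := by
  rw [pos_iff_ne_zero]
  intro h
  have : IsEmpty (Fin (F.rank 0)) := by rw [h]; infer_instance
  exact not_subsingleton M F.aug_surjective.subsingleton

theorem setOf_betti_ne_zero (F : MinimalGradedFreeResolution (k := k) (n := n) 𝓜) (i : ℕ) :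
    {j | F.betti i j ≠ 0} = Set.range (F.deg i) := by
  ext j
  simp [betti, Finset.filter_eq_empty_iff]

theorem isGreatest_maxShift (F : MinimalGradedFreeResolution (k := k) (n := n) 𝓜) {i : ℕ}
    (a : Fin (F.rank i)) : IsGreatest {j | F.betti i j ≠ 0} (F.maxShift i) := by
  have hne : (Set.range (F.deg i)).Nonempty := ⟨_, a, rfl⟩
  have hbdd : BddAbove (Set.range (F.deg i)) := (Set.finite_range _).bddAbove
  rw [maxShift, setOf_betti_ne_zero]
  exact ⟨Int.csSup_mem hne hbdd, fun j hj => le_csSup hbdd hj⟩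

theorem rank_pos (F : MinimalGradedFreeResolution (k := k) (n := n) 𝓜)
    {c : ℕ} (hc : Module.codim (PolyRing k n) M = c) {i : ℕ} (hi : i ≤ c) : 0 < F.rank i := by
  induction i with
  | zero =>
    have : Nontrivial M := by
      by_contra h
      rw [not_nontrivial_iff_subsingleton] at h
      rw [Module.codim, Module.annihilator_eq_top_iff.2 h, Ideal.height_top] at hc
      simp at hc
    exact F.rank_zero_pos
  | succ i ih =>
    obtain ⟨b, -⟩ := F.exists_deg_lt hc hi ⟨0, ih (by omega)⟩
    exact b.pos

end MinimalGradedFreeResolution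

theorem mainTheorem8 {k : Type*} [Field k] {n : ℕ} {M : Type*} [AddCommGroup M]
    [Module (PolyRing k n) M] [Module.Finite (PolyRing k n) M]
    (𝓜 : ℤ → AddSubgroup M) [DirectSum.Decomposition 𝓜]
    [SetLike.GradedSMul (stdGrading k n) 𝓜]
    (c : ℕ) (hc : Module.codim (PolyRing k n) M = c)
    (F : MinimalGradedFreeResolution (k := k) (n := n) 𝓜) (i : ℕ) (hi : i < c) :
    IsGreatest {j | F.betti i j ≠ 0} (F.maxShift i) ∧
    IsGreatest {j | F.betti (i + 1) j ≠ 0} (F.maxShift (i + 1)) ∧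
    F.maxShift i < F.maxShift (i + 1) := by
  have h₀ := F.isGreatest_maxShift ⟨0, F.rank_pos hc hi.le⟩
  have h₁ := F.isGreatest_maxShift ⟨0, F.rank_pos hc hi⟩
  refine ⟨h₀, h₁, ?_⟩
  rw [F.setOf_betti_ne_zero] at h₀ h₁
  obtain ⟨a, ha⟩ := h₀.1
  obtain ⟨b, hb⟩ := F.exists_deg_lt hc hi a
  exact ha ▸ hb.trans_le (h₁.2 ⟨b, rfl⟩)
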